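/- Let $X$ be a smooth manifold (without boundary, Hausdorff and second countable, of some finite dimension), $Y$ a compact Polish space, $\mu$ and $\nu$ Borel probability measures on $X$ and $Y$, and $c\colon X\times Y\to[0,\infty)$ a continuous function such that - for every $y\in Y$ the function $c(\cdot,y)$ is differentiable on $X$; - $c(\cdot,y)$ is locally Lipschitz uniformly in $y$: for every chart $\varphi$ of an atlas of $X$ and every $v\in\operatorname{range}\varphi$ there are a neighbourhood $U\subset\operatorname{range}\varphi$ of $v$ and a constant $K\ge 0$, both independent of $y$, such that $c(\varphi^{-1}(\cdot),y)$ is $K$-Lipschitz on $U$ for all $y\in Y$; - $T_c(\mu,\nu)=\inf_{\pi}\int c\,d\pi<\infty$, where $\pi$ ranges over the set $\mathcal C(\mu,\nu)$ of probability measures on $X\times Y$ with marginals $\mu$ and $\nu$. For $g\colon Y\to\mathbb R\cup\{-\infty\}$ and $f\colon X\to\mathbb R\cup\{-\infty\}$ put $g^c(x)=\inf_{y\in Y}(c(x,y)-g(y))$ and $f^c(y)=\inf_{x\in X}(c(x,y)-f(x))$. A function $f\colon X\to\mathbb R\cup\{-\infty\}$ is called $c$-concave if $f=g^c$ for some $g\colon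 Y\to\mathbb R\cup\{-\infty\}$ and $f\not\equiv-\infty$. A (generalized) Kantorovich potential is a $c$-concave $f$ for which some $\pi\in\mathcal C(\mu,\nu)$ satisfies $$T_c(\mu,\nu)=\int c\,d\pi=\int \big(f(x)+f^c(y)\big)\,d\pi(x,y).$$ If $M=\operatorname{int}(\operatorname{supp}\mu)$ is connected and $\operatorname{cl}(M)=\operatorname{supp}\mu$, then the Kantorovich potentials are almost surely unique up to constant shifts: for any two Kantorovich potentials $f_1,f_2$ there is $a\in\mathbb R$ such that $f_1-f_2=a$ holds $\mu$-almost surely. -/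

import Mathlib

open Set Filter Topology MeasureTheory
open scoped NNReal ENNReal Manifold ContDiff

/-- The `c`-transform `g ↦ gᶜ`, `gᶜ(x) = inf_y c(x, y) - g(y)`. Functions with values in
`ℝ ∪ {-∞}` are modelled as `EReal`-valued functions that avoid `⊤`; for those,
`c x y - g y` is never an indeterminate form. The transform of a function `f` on `X` is
obtained from the flipped cost, `cTransform (fun y x => c x y) f`. -/
noncomputable def cTransform {X Y : Type*} (c : X → Y → ℝ) (g : Y → EReal) : X → EReal :=
  fun x => ⨅ y, ((c x y : ℝ) : EReal) - g y

/-- The transform `fᶜ(y) = inf_x c(x, y) - f(x)` of a function on the first space. -/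
noncomputable def cConjugate {X Y : Type*} (c : X → Y → ℝ) (f : X → EReal) : Y → EReal :=
  cTransform (fun y x => c x y) f

/-- `f : X → ℝ ∪ {-∞}` is `c`-concave: it is the `c`-transform of some `g : Y → ℝ ∪ {-∞}`
and is not `-∞` everywhere. -/
def IsCConcave {X Y : Type*} (c : X → Y → ℝ) (f : X → EReal) : Prop :=
  (∀ x, f x ≠ ⊤) ∧ (∃ x, f x ≠ ⊥) ∧
    ∃ g : Y → EReal, (∀ y, g y ≠ ⊤) ∧ f = cTransform c g

/-- The transport plans between `μ` and `ν`: measures on the product with marginals `μ`, `ν`. -/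
def transportPlans {X Y : Type*} [MeasurableSpace X] [MeasurableSpace Y]
    (μ : Measure X) (ν : Measure Y) : Set (Measure (X × Y)) :=
  {π | π.map Prod.fst = μ ∧ π.map Prod.snd = ν}

/-- The cost `∫ c dπ ∈ [0, ∞]` of a plan, for a non-negative cost function `c`. -/
noncomputable def planCost {X Y : Type*} [MeasurableSpace X] [MeasurableSpace Y]
    (c : X → Y → ℝ) (π : Measure (X × Y)) : ℝ≥0∞ :=
  ∫⁻ p, ENNReal.ofReal (c p.1 p.2) ∂π

/-- The optimal transport cost `T_c(μ, ν) = inf_π ∫ c dπ ∈ [0, ∞]`. -/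
noncomputable def transportCost {X Y : Type*} [MeasurableSpace X] [MeasurableSpace Y]
    (c : X → Y → ℝ) (μ : Measure X) (ν : Measure Y) : ℝ≥0∞ :=
  ⨅ π ∈ transportPlans μ ν, planCost c π

/-- The integral `∫ h⁺ dπ - ∫ h⁻ dπ` of an extended real function. It is only used for
functions whose positive part has a finite integral, so that `∞ - ∞` does not occur. -/
noncomputable def extIntegral {Ω : Type*} [MeasurableSpace Ω]
    (π : Measure Ω) (h : Ω → EReal) : EReal :=
  ((∫⁻ p, (h p).toENNReal ∂π : ℝ≥0∞) : EReal) - ((∫⁻ p, (-(h p)).toENNReal ∂π : ℝ≥0∞) : EReal)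

/-- The (generalized) Kantorovich potentials: the `c`-concave `f` such that
`T_c(μ, ν) = ∫ c dπ = ∫ (f ⊕ fᶜ) dπ` for some transport plan `π` (which is then optimal). -/
def kantorovichPotentials {X Y : Type*} [MeasurableSpace X] [MeasurableSpace Y]
    (c : X → Y → ℝ) (μ : Measure X) (ν : Measure Y) : Set (X → EReal) :=
  {f | IsCConcave c f ∧ ∃ π ∈ transportPlans μ ν,
    planCost c π = transportCost c μ ν ∧
    extIntegral π (fun p => f p.1 + cConjugate c f p.2) =
      ((transportCost c μ ν : ℝ≥0∞) : EReal)}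

/-- The Kantorovich potentials are almost surely unique (up to constant shifts): the difference
of any two of them is `μ`-almost surely equal to a real constant. -/
def AlmostSurelyUniquePotentials {X Y : Type*} [MeasurableSpace X] [MeasurableSpace Y]
    (c : X → Y → ℝ) (μ : Measure X) (ν : Measure Y) : Prop :=
  ∀ f₁ ∈ kantorovichPotentials c μ ν, ∀ f₂ ∈ kantorovichPotentials c μ ν,
    ∃ a : ℝ, ∀ᵐ x ∂μ, f₁ x - f₂ x = (a : EReal)

/-- The family `c(·, y)`, `y ∈ Y`, is locally Lipschitz uniformly in `y`: in every chart of the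
atlas, each point of the range of the chart has a neighbourhood and a Lipschitz constant that
serve for all `y` at once. -/
def LocallyLipschitzUniformly {H X Y : Type*} [PseudoMetricSpace H] [TopologicalSpace X]
    [ChartedSpace H X] (c : X → Y → ℝ) : Prop :=
  ∀ φ ∈ atlas H X, ∀ v ∈ φ.target, ∃ K : ℝ≥0, ∃ U ∈ 𝓝 v, U ⊆ φ.target ∧
    ∀ y, LipschitzOnWith K (fun u => c (φ.symm u) y) U

/-! Fix one optimal plan `π`. Where `F ⊕ Fᶜ = c`, the function `c(·, y) - F` is minimal at `x`, so a
potential differentiable at `x` has the derivative of `c(·, y)` there. Two potentials touched by the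
same `c(·, y)` thus have equal derivatives. Each potential comes with its own optimal plan, but
equality passes to `π` (`ae_add_eq_of_ae_add_eq`): truncated potentials have the same integral under
all plans. Both contact sets then have full `π`-measure. They are closed and `Y` is compact, so a
common `y` exists over every point of the support of `μ`, not merely almost every one
(`exists_mem_of_mem_support_map_fst`). Potentials inherit the Lipschitz bounds of `c`, so in a chart
their difference is constant along segments (`sub_eq_sub_of_common_upper_support`). Connectedness of
the interior and continuity up to its closure finish the proof. -/

/-- Two Lipschitz functions that have a common differentiable upper support function at each point
of a convex set differ by a constant on that set. -/
theorem sub_eq_sub_of_common_upper_support {E : Type*} [NormedAddCommGroup E] [NormedSpace ℝ E]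
    {B : Set E} (hB : Convex ℝ B) (hBo : IsOpen B) {K₁ K₂ : ℝ≥0} {f₁ f₂ : E → ℝ}
    (h₁ : LipschitzOnWith K₁ f₁ B) (h₂ : LipschitzOnWith K₂ f₂ B)
    (hγ : ∀ u ∈ B, ∃ γ : E → ℝ, DifferentiableAt ℝ γ u ∧
      (∀ w ∈ B, f₁ w - γ w ≤ f₁ u - γ u) ∧ (∀ w ∈ B, f₂ w - γ w ≤ f₂ u - γ u))
    {u v : E} (hu : u ∈ B) (hv : v ∈ B) : f₁ v - f₂ v = f₁ u - f₂ u := by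
  set l : ℝ → E := fun t => AffineMap.lineMap u v t with hl
  have hlip : LipschitzWith (nndist u v) l := lipschitzWith_lineMap u v
  have hldiff : Differentiable ℝ l := by
    intro t
    exact (AffineMap.hasDerivAt_lineMap).differentiableAt
  have hmaps : MapsTo l (uIcc 0 1) B := by
    intro t ht
    rw [uIcc_of_le zero_le_one] at ht
    exact hB.lineMap_mem hu hv ht
  -- Restricting to the segment makes one-variable almost everywhere differentiability enough;
  -- Rademacher's theorem on `E` would say nothing about a given segment.
  have ac₁ : AbsolutelyContinuousOnInterval (f₁ ∘ l) 0 1 :=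
    (h₁.comp hlip.lipschitzOnWith hmaps).absolutelyContinuousOnInterval
  have ac₂ : AbsolutelyContinuousOnInterval (f₂ ∘ l) 0 1 :=
    (h₂.comp hlip.lipschitzOnWith hmaps).absolutelyContinuousOnInterval
  have key : ∀ᵐ t : ℝ, t ∈ uIcc (0 : ℝ) 1 → HasDerivAt (f₁ ∘ l - f₂ ∘ l) 0 t := by
    filter_upwards [ac₁.ae_differentiableAt, ac₂.ae_differentiableAt] with t d₁ d₂ ht
    obtain ⟨γ, hγd, hγ₁, hγ₂⟩ := hγ (l t) (hmaps ht)
    have hev : ∀ᶠ s in 𝓝 t, l s ∈ B :=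
      hlip.continuous.continuousAt.eventually (hBo.mem_nhds (hmaps ht))
    have dγ : HasDerivAt (γ ∘ l) (deriv (γ ∘ l) t) t :=
      (DifferentiableAt.comp t hγd (hldiff t)).hasDerivAt
    have aux : ∀ f : E → ℝ, DifferentiableAt ℝ (f ∘ l) t →
        (∀ w ∈ B, f w - γ w ≤ f (l t) - γ (l t)) →
        HasDerivAt (f ∘ l) (deriv (γ ∘ l) t) t := by
      intro f hd hf
      have hmax : IsLocalMax (f ∘ l - γ ∘ l) t := hev.mono fun s hs => hf _ hs
      have h0 := hmax.hasDerivAt_eq_zero (hd.hasDerivAt.sub dγ)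
      rw [← sub_eq_zero.mp h0]
      exact hd.hasDerivAt
    simpa using (aux f₁ (d₁ ht) hγ₁).sub (aux f₂ (d₂ ht) hγ₂)
  obtain ⟨C, hC⟩ := (ac₁.sub ac₂).const_of_ae_hasDerivAt_zero key
  have e0 := hC 0 left_mem_uIcc
  have e1 := hC 1 right_mem_uIcc
  simp only [hl, Pi.sub_apply, Function.comp_apply, AffineMap.lineMap_apply_zero,
    AffineMap.lineMap_apply_one] at e0 e1
  rw [e0, e1]

/-! ### Contact sets and conjugates -/

/-- A closed set of full measure for a measure on a product with compact second factor
has points above every point of the support of the first marginal. -/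
theorem exists_mem_of_mem_support_map_fst {X Y : Type*} [TopologicalSpace X]
    [MeasurableSpace X] [BorelSpace X] [TopologicalSpace Y] [CompactSpace Y] [MeasurableSpace Y]
    {π : Measure (X × Y)} {Γ : Set (X × Y)} (hΓ : IsClosed Γ) (hπ : ∀ᵐ p ∂π, p ∈ Γ) {x : X}
    (hx : x ∈ (π.map Prod.fst).support) : ∃ y, (x, y) ∈ Γ := by
  have hcl : IsClosed (Prod.fst '' Γ) := isClosedMap_fst_of_compactSpace _ hΓ
  have hae : Prod.fst '' Γ ∈ ae (π.map Prod.fst) := by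
    rw [mem_ae_map_iff measurable_fst.aemeasurable hcl.measurableSet]
    exact hπ.mono fun p hp => mem_image_of_mem _ hp
  obtain ⟨p, hp, rfl⟩ := Measure.support_subset_of_isClosed hcl hae hx
  exact ⟨p.2, hp⟩

/-- The pairs `(x, y)` at which `x` minimizes `c(·, y) - F`. -/
def contactSet {X Y : Type*} (c : X → Y → ℝ) (F : X → ℝ) : Set (X × Y) :=
  {p | ∀ x', c p.1 p.2 - F p.1 ≤ c x' p.2 - F x'}

theorem isClosed_contactSet {X Y : Type*} [TopologicalSpace X] [TopologicalSpace Y]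
    {c : X → Y → ℝ} (hc : Continuous fun p : X × Y => c p.1 p.2) {F : X → ℝ}
    (hF : Continuous F) : IsClosed (contactSet c F) := by
  have h : contactSet c F = ⋂ x', {p | c p.1 p.2 - F p.1 ≤ c x' p.2 - F x'} := by
    ext p; simp [contactSet]
  rw [h]
  refine isClosed_iInter fun x' => isClosed_le (hc.sub (hF.comp continuous_fst)) ?_
  exact (hc.comp (continuous_const.prodMk continuous_snd)).sub continuous_const

theorem cConjugate_le {X Y : Type*} (c : X → Y → ℝ) (F : X → ℝ) (x : X) (y : Y) :
    cConjugate c (fun x => (F x : EReal)) y ≤ ((c x y - F x : ℝ) : EReal) := by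
  rw [EReal.coe_sub]
  exact iInf_le _ x

theorem mem_contactSet_of_le {X Y : Type*} {c : X → Y → ℝ} {F : X → ℝ} {x : X} {y : Y}
    (h : ((c x y - F x : ℝ) : EReal) ≤ cConjugate c (fun x => (F x : EReal)) y) :
    (x, y) ∈ contactSet c F := fun x' =>
  EReal.coe_le_coe_iff.mp (h.trans (cConjugate_le c F x' y))

/-- The infimum may be uncountable; upper semicontinuity survives it, and gives measurability. -/
theorem measurable_cConjugate {X Y : Type*} [TopologicalSpace X] [TopologicalSpace Y]
    [MeasurableSpace Y] [OpensMeasurableSpace Y] {c : X → Y → ℝ}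
    (hc : Continuous fun p : X × Y => c p.1 p.2) (F : X → ℝ) :
    Measurable (cConjugate c fun x => (F x : EReal)) := by
  refine UpperSemicontinuous.measurable ?_
  refine upperSemicontinuous_iInf fun x => Continuous.upperSemicontinuous ?_
  simp_rw [← EReal.coe_sub]
  exact continuous_coe_real_ereal.comp
    ((hc.comp (continuous_const.prodMk continuous_id)).sub continuous_const)

/-! ### Regularity of `c`-concave functions -/

/-- For a compact second space and a non-negative continuous cost, a `c`-concave function is
real-valued and bounded below, and its conjugate is bounded above. -/
theorem IsCConcave.exists_real {X Y : Type*} [TopologicalSpace X] [TopologicalSpace Y]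
    [CompactSpace Y] {c : X → Y → ℝ} (hc_nonneg : ∀ x y, 0 ≤ c x y)
    (hc : Continuous fun p : X × Y => c p.1 p.2) {f : X → EReal} (hf : IsCConcave c f) :
    ∃ (F : X → ℝ) (C : ℝ), f = (fun x => (F x : EReal)) ∧ (∀ x, -C ≤ F x) ∧
      ∀ y, cConjugate c (fun x => (F x : EReal)) y ≤ (C : EReal) := by
  obtain ⟨htop, ⟨x₀, hx₀⟩, g, hg, rfl⟩ := hf
  set f := cTransform c g with hf
  obtain ⟨M, hM⟩ := isCompact_univ.bddAbove_image
    (hc.comp (continuous_const.prodMk continuous_id : Continuous fun y : Y => (x₀, y))).continuousOn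
  have hM' : ∀ y, c x₀ y ≤ M := fun y => hM ⟨y, mem_univ y, rfl⟩
  set r := (f x₀).toReal
  have hr : (r : EReal) = f x₀ := EReal.coe_toReal (htop x₀) hx₀
  -- Finiteness at the single point `x₀` bounds `g` above; with `c ≥ 0` this bounds `f` below
  -- everywhere.
  have hgC : ∀ y, g y ≤ ((M - r : ℝ) : EReal) := by
    intro y
    have h1 : f x₀ ≤ (c x₀ y : EReal) - g y := iInf_le _ y
    rw [← hr] at h1
    induction hgy : g y using EReal.rec with
    | bot => exact bot_le
    | top => exact absurd hgy (hg y)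
    | coe s =>
      rw [hgy, ← EReal.coe_sub, EReal.coe_le_coe_iff] at h1
      rw [EReal.coe_le_coe_iff]
      linarith [hM' y]
  have hlow : ∀ x, ((-(M - r) : ℝ) : EReal) ≤ f x := by
    intro x
    refine le_iInf fun y => ?_
    have h1 := hgC y
    induction hgy : g y using EReal.rec with
    | bot => simp
    | top => exact absurd hgy (hg y)
    | coe s =>
      rw [hgy, EReal.coe_le_coe_iff] at h1
      rw [← EReal.coe_sub, EReal.coe_le_coe_iff]
      linarith [hc_nonneg x y]
  have hF : ∀ x, ((f x).toReal : EReal) = f x := fun x =>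
    EReal.coe_toReal (htop x) fun h => by
      have := hlow x
      rw [h, le_bot_iff] at this
      exact EReal.coe_ne_bot _ this
  refine ⟨fun x => (f x).toReal, M - r, funext fun x => (hF x).symm, fun x => ?_, fun y => ?_⟩
  · have := hlow x
    rwa [← hF x, EReal.coe_le_coe_iff] at this
  · refine (cConjugate_le c _ x₀ y).trans ?_
    rw [EReal.coe_le_coe_iff]
    linarith [hM' y]

/-- The error `e` does not depend on `y`, so it passes through the infimum. -/
theorem cTransform_le_add {X Y : Type*} {c : X → Y → ℝ} {g : Y → EReal} (hg : ∀ y, g y ≠ ⊤)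
    {F : X → ℝ} (hF : cTransform c g = fun x => (F x : EReal)) {x x' : X} {e : ℝ}
    (h : ∀ y, c x' y ≤ c x y + e) : F x' ≤ F x + e := by
  have h1 : ((F x' - e : ℝ) : EReal) ≤ cTransform c g x := by
    refine le_iInf fun y => ?_
    have h2 : (F x' : EReal) ≤ (c x' y : EReal) - g y := congrFun hF x' ▸ iInf_le _ y
    induction hgy : g y using EReal.rec with
    | bot => simp
    | top => exact absurd hgy (hg y)
    | coe s =>
      rw [hgy, ← EReal.coe_sub, EReal.coe_le_coe_iff] at h2
      rw [← EReal.coe_sub, EReal.coe_le_coe_iff]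
      linarith [h y]
  rw [hF, EReal.coe_le_coe_iff] at h1
  linarith

theorem lipschitzOnWith_of_isCConcave {Z X Y : Type*} [PseudoMetricSpace Z] {c : X → Y → ℝ}
    {F : X → ℝ} (hF : IsCConcave c fun x => (F x : EReal)) {s : Z → X} {K : ℝ≥0} {U : Set Z}
    (h : ∀ y, LipschitzOnWith K (fun u => c (s u) y) U) : LipschitzOnWith K (fun u => F (s u)) U := by
  obtain ⟨-, -, g, hg, hFg⟩ := hF
  refine LipschitzOnWith.of_le_add_mul K fun u hu v hv => ?_
  exact cTransform_le_add hg hFg.symm fun y => (h y).le_add_mul hu hv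

theorem continuous_of_isCConcave {H X Y : Type*} [PseudoMetricSpace H] [TopologicalSpace X]
    [ChartedSpace H X] {c : X → Y → ℝ} (hc_lip : LocallyLipschitzUniformly (H := H) c)
    {F : X → ℝ} (hF : IsCConcave c fun x => (F x : EReal)) : Continuous F := by
  refine continuous_iff_continuousAt.mpr fun x => ?_
  obtain ⟨K, U, hU, -, hK⟩ :=
    hc_lip (chartAt H x) (chart_mem_atlas H x) _ (mem_chart_target H x)
  have h := (lipschitzOnWith_of_isCConcave hF hK).continuousOn.continuousAt hU
  have h' := h.comp ((chartAt H x).continuousAt (mem_chart_source H x))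
  refine h'.congr ?_
  filter_upwards [(chartAt H x).open_source.mem_nhds (mem_chart_source H x)] with z hz
  simp [(chartAt H x).left_inv hz]

/-! ### Equality almost everywhere and its transfer between plans -/

/-- If `h ≤ k` with `k` non-negative of finite integral, then `h` has the same integral as `k`
only if `h = k` almost everywhere. -/
theorem ae_eq_of_extIntegral_eq {Ω : Type*} [MeasurableSpace Ω] {π : Measure Ω}
    {h : Ω → EReal} (hm : Measurable h) {k : Ω → ℝ} (hkm : Measurable k) (hk : ∀ p, 0 ≤ k p)
    (hle : ∀ p, h p ≤ (k p : EReal)) (hfin : ∫⁻ p, ENNReal.ofReal (k p) ∂π ≠ ⊤)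
    (heq : extIntegral π h = ((∫⁻ p, ENNReal.ofReal (k p) ∂π : ℝ≥0∞) : EReal)) :
    ∀ᵐ p ∂π, h p = (k p : EReal) := by
  set T := ∫⁻ p, ENNReal.ofReal (k p) ∂π
  have hpw : ∀ p, (h p).toENNReal ≤ ENNReal.ofReal (k p) := fun p =>
    (EReal.toENNReal_le_toENNReal (hle p)).trans_eq (by simp [EReal.toENNReal_of_ne_top])
  set A := ∫⁻ p, (h p).toENNReal ∂π
  set B := ∫⁻ p, (-(h p)).toENNReal ∂π
  have hAT : A ≤ T := lintegral_mono hpw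
  have hAfin : A ≠ ⊤ := ne_top_of_le_ne_top hfin hAT
  have heq' : (A : EReal) - (B : EReal) = (T : EReal) := heq
  -- In `EReal`, subtracting `⊤` always yields `⊥`, which is not the value `T`.
  have hBfin : B ≠ ⊤ := by
    intro hBt
    rw [hBt, EReal.coe_ennreal_top, sub_eq_add_neg, EReal.neg_top, EReal.add_bot] at heq'
    exact absurd heq'.symm (EReal.coe_ennreal_ne_bot T)
  have hTBA : T + B = A := by
    have hcan : ((T + B : ℝ≥0∞) : EReal) = A := by
      rw [EReal.coe_ennreal_add, ← heq', ← EReal.coe_ennreal_toReal hBfin, EReal.sub_add_cancel]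
    exact_mod_cast hcan
  have hB0 : B = 0 := by
    have h4 : T + B ≤ T + 0 := by rw [hTBA, add_zero]; exact hAT
    exact le_zero_iff.mp ((ENNReal.add_le_add_iff_left hfin).mp h4)
  have hAeqT : A = T := by rw [← hTBA, hB0, add_zero]
  have e1 : (fun p => (h p).toENNReal) =ᵐ[π] fun p => ENNReal.ofReal (k p) :=
    ae_eq_of_ae_le_of_lintegral_le (ae_of_all _ hpw) hAfin
      hkm.ennreal_ofReal.aemeasurable hAeqT.ge
  have e2 : ∀ᵐ p ∂π, (-(h p)).toENNReal = 0 := by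
    have := (lintegral_eq_zero_iff (hm.neg.ereal_toENNReal)).mp hB0
    exact this
  filter_upwards [e1, e2] with p h1 h2
  have h3 : 0 ≤ h p := by
    have := EReal.toENNReal_eq_zero_iff.mp h2
    rwa [EReal.neg_le, neg_zero] at this
  have h4 : ((h p).toENNReal : EReal) = ((ENNReal.ofReal (k p) : ℝ≥0∞) : EReal) := by
    exact congrArg _ h1
  rw [EReal.coe_toENNReal h3] at h4
  rw [h4, EReal.coe_ennreal_ofReal, max_eq_left (hk p)]

/-- The truncation of `F ⊕ G` at level `n`. -/
noncomputable def truncSum {X Y : Type*} (F : X → ℝ) (G : Y → EReal) (n : ℕ) (p : X × Y) : ℝ :=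
  min (F p.1) n + (max (G p.2) ((-(n : ℝ) : ℝ) : EReal)).toReal

theorem truncSum_of_coe {X Y : Type*} {F : X → ℝ} {G : Y → EReal} {n : ℕ} {p : X × Y} {s : ℝ}
    (h : G p.2 = s) : truncSum F G n p = min (F p.1) n + max s (-n) := by
  rw [truncSum, h, ← EReal.coe_strictMono.monotone.map_max, EReal.toReal_coe]

theorem truncSum_of_bot {X Y : Type*} {F : X → ℝ} {G : Y → EReal} {n : ℕ} {p : X × Y}
    (h : G p.2 = ⊥) : truncSum F G n p = min (F p.1) n - n := by
  rw [truncSum, h, max_eq_right bot_le, EReal.toReal_coe, sub_eq_add_neg]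

/-- If `G` is cut, the sum is at most `n - n = 0 ≤ k`; otherwise cutting `F` only lowers it. -/
theorem truncSum_le {X Y : Type*} {F : X → ℝ} {G : Y → EReal} {C : ℝ} (hG : ∀ y, G y ≤ (C : EReal))
    {n : ℕ} {p : X × Y} {k : ℝ} (hk : 0 ≤ k) (hle : (F p.1 : EReal) + G p.2 ≤ k) :
    truncSum F G n p ≤ k := by
  have hGC := hG p.2
  induction hs : G p.2 using EReal.rec with
  | bot =>
    rw [truncSum_of_bot hs]
    linarith [min_le_right (F p.1) n]
  | top => rw [hs] at hGC; exact absurd hGC (by simp)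
  | coe s =>
    rw [truncSum_of_coe hs]
    rw [hs, EReal.coe_le_coe_iff] at hGC
    rw [hs, ← EReal.coe_add, EReal.coe_le_coe_iff] at hle
    rcases le_total (F p.1) n with h | h <;> rcases le_total s (-n) with h' | h' <;>
      simp only [min_eq_left, min_eq_right, max_eq_left, max_eq_right, h, h'] <;> linarith

/-- If `F` is cut, the sum is at least `n - n`; otherwise cutting `G` only raises it above `k`. -/
theorem truncSum_nonneg {X Y : Type*} {F : X → ℝ} {G : Y → EReal} {n : ℕ}
    {p : X × Y} {k : ℝ} (hk : 0 ≤ k)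
    (heq : (F p.1 : EReal) + G p.2 = k) : 0 ≤ truncSum F G n p := by
  induction hs : G p.2 using EReal.rec with
  | bot => rw [hs] at heq; simp at heq
  | top => rw [hs] at heq; simp at heq
  | coe s =>
    rw [truncSum_of_coe hs]
    rw [hs, ← EReal.coe_add, EReal.coe_eq_coe_iff] at heq
    rcases le_total (F p.1) n with h | h <;> rcases le_total s (-n) with h' | h' <;>
      simp only [min_eq_left, min_eq_right, max_eq_left, max_eq_right, h, h'] <;> linarith

theorem eventually_truncSum_eq {X Y : Type*} {F : X → ℝ} {G : Y → EReal} {p : X × Y} {s : ℝ}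
    (h : G p.2 = s) : ∀ᶠ n : ℕ in atTop, truncSum F G n p = F p.1 + s := by
  filter_upwards [eventually_ge_atTop ⌈F p.1⌉₊, eventually_ge_atTop ⌈-s⌉₊] with n h₁ h₂
  rw [truncSum_of_coe h, min_eq_left (Nat.ceil_le.mp h₁),
    max_eq_left (by linarith [Nat.ceil_le.mp h₂])]

/-- Integrals of bounded sums `u ⊕ v` depend only on the marginals. -/
theorem integral_add_eq_of_transportPlans {X Y : Type*} [MeasurableSpace X] [MeasurableSpace Y]
    {μ : Measure X} {ν : Measure Y} {u : X → ℝ} {v : Y → ℝ} (hu : Integrable u μ)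
    (hv : Integrable v ν) {π : Measure (X × Y)} (hπ : π ∈ transportPlans μ ν) :
    Integrable (fun p : X × Y => u p.1 + v p.2) π ∧
      ∫ p, (u p.1 + v p.2) ∂π = ∫ x, u x ∂μ + ∫ y, v y ∂ν := by
  obtain ⟨rfl, rfl⟩ := hπ
  have iu : Integrable (fun p : X × Y => u p.1) π := hu.comp_measurable measurable_fst
  have iv : Integrable (fun p : X × Y => v p.2) π := hv.comp_measurable measurable_snd
  refine ⟨iu.add iv, ?_⟩
  rw [integral_add iu iv, integral_map measurable_fst.aemeasurable hu.1,
    integral_map measurable_snd.aemeasurable hv.1]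

/-- If `F ⊕ G ≤ c` holds with equality almost surely for one optimal plan, then equality holds
almost surely for every plan with the same finite cost, without integrability of `F` or `G`. -/
theorem ae_add_eq_of_ae_add_eq {X Y : Type*} [MeasurableSpace X] [MeasurableSpace Y]
    {μ : Measure X} [IsProbabilityMeasure μ] {ν : Measure Y} [IsProbabilityMeasure ν]
    {c : X → Y → ℝ} (hc_nonneg : ∀ x y, 0 ≤ c x y) (hcm : Measurable fun p : X × Y => c p.1 p.2)
    {F : X → ℝ} (hFm : Measurable F) {G : Y → EReal} (hGm : Measurable G) {C : ℝ}
    (hF : ∀ x, -C ≤ F x) (hG : ∀ y, G y ≤ (C : EReal))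
    (hle : ∀ x y, (F x : EReal) + G y ≤ (c x y : EReal))
    {π π' : Measure (X × Y)} (hπ : π ∈ transportPlans μ ν) (hπ' : π' ∈ transportPlans μ ν)
    (hcost : planCost c π' = planCost c π) (hfin : planCost c π ≠ ⊤)
    (heq : ∀ᵐ p ∂π, (F p.1 : EReal) + G p.2 = (c p.1 p.2 : EReal)) :
    ∀ᵐ p ∂π', (F p.1 : EReal) + G p.2 = (c p.1 p.2 : EReal) := by
  have hc0 : ∀ p : X × Y, 0 ≤ c p.1 p.2 := fun p => hc_nonneg _ _
  have hint : ∀ ρ : Measure (X × Y), planCost c ρ ≠ ⊤ →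
      Integrable (fun p : X × Y => c p.1 p.2) ρ := fun ρ hρ =>
    (lintegral_ofReal_ne_top_iff_integrable hcm.aestronglyMeasurable
      (ae_of_all _ hc0)).mp hρ
  have hcint := hint π hfin
  have hcint' := hint π' (hcost ▸ hfin)
  have hcc : ∫ p, c p.1 p.2 ∂π' = ∫ p, c p.1 p.2 ∂π := by
    rw [integral_eq_lintegral_of_nonneg_ae (ae_of_all _ hc0) hcm.aestronglyMeasurable,
      integral_eq_lintegral_of_nonneg_ae (ae_of_all _ hc0) hcm.aestronglyMeasurable]
    exact congrArg _ hcost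
  have hu : ∀ n : ℕ, Integrable (fun x => min (F x) n) μ := fun n => by
    refine Integrable.of_mem_Icc (-|C|) n (hFm.min measurable_const).aemeasurable
      (ae_of_all _ fun x => ⟨le_min ?_ ?_, min_le_right _ _⟩)
    · linarith [hF x, le_abs_self C]
    · linarith [abs_nonneg C, (Nat.cast_nonneg n : (0 : ℝ) ≤ n)]
  have hv : ∀ n : ℕ, Integrable (fun y => (max (G y) ((-(n : ℝ) : ℝ) : EReal)).toReal) ν :=
    fun n => by
    refine Integrable.of_mem_Icc (-n) (max C (-n))
      (hGm.max measurable_const).ereal_toReal.aemeasurable (ae_of_all _ fun y => ?_)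
    have hGC := hG y
    induction hs : G y using EReal.rec with
    | bot =>
      rw [max_eq_right bot_le, EReal.toReal_coe]
      exact ⟨le_rfl, le_max_right _ _⟩
    | top => rw [hs] at hGC; exact absurd hGC (by simp)
    | coe s =>
      rw [hs, EReal.coe_le_coe_iff] at hGC
      rw [← EReal.coe_strictMono.monotone.map_max, EReal.toReal_coe]
      exact ⟨le_max_right _ _, max_le_max_right _ hGC⟩
  have hI : ∀ n, Integrable (truncSum F G n) π := fun n =>
    (integral_add_eq_of_transportPlans (hu n) (hv n) hπ).1
  have hI' : ∀ n, Integrable (truncSum F G n) π' := fun n =>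
    (integral_add_eq_of_transportPlans (hu n) (hv n) hπ').1
  have hII : ∀ n, ∫ p, truncSum F G n p ∂π' = ∫ p, truncSum F G n p ∂π := fun n =>
    (integral_add_eq_of_transportPlans (hu n) (hv n) hπ').2.trans
      (integral_add_eq_of_transportPlans (hu n) (hv n) hπ).2.symm
  have hnn : ∀ n p, 0 ≤ c p.1 p.2 - truncSum F G n p := fun n p =>
    sub_nonneg.mpr (truncSum_le hG (hc0 p) (hle _ _))
  -- Under `π` equality holds, so `0 ≤ truncSum ≤ c` and `c` dominates.
  have hlim : Tendsto (fun n => ∫ p, truncSum F G n p ∂π) atTop (𝓝 (∫ p, c p.1 p.2 ∂π)) := by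
    refine tendsto_integral_of_dominated_convergence (fun p => c p.1 p.2)
      (fun n => (hI n).1) hcint (fun n => ?_) ?_
    · filter_upwards [heq] with p hp
      rw [Real.norm_of_nonneg (truncSum_nonneg (hc0 p) hp)]
      exact truncSum_le hG (hc0 p) (hle _ _)
    · filter_upwards [heq] with p hp
      induction hs : G p.2 using EReal.rec with
      | bot => rw [hs] at hp; simp at hp
      | top => rw [hs] at hp; simp at hp
      | coe s =>
        rw [hs, ← EReal.coe_add, EReal.coe_eq_coe_iff] at hp
        rw [← hp]
        exact tendsto_nhds_of_eventually_eq (eventually_truncSum_eq hs)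
  have hgap : Tendsto (fun n => ∫⁻ p, ENNReal.ofReal (c p.1 p.2 - truncSum F G n p) ∂π') atTop
      (𝓝 0) := by
    have h1 : Tendsto (fun n => ENNReal.ofReal (∫ p, (c p.1 p.2 - truncSum F G n p) ∂π')) atTop
        (𝓝 0) := by
      rw [← ENNReal.ofReal_zero]
      refine ENNReal.tendsto_ofReal ?_
      simp_rw [fun n => integral_sub hcint' (hI' n), hII, hcc]
      simpa using hlim.const_sub (∫ p, c p.1 p.2 ∂π)
    exact h1.congr fun n =>
      ofReal_integral_eq_lintegral_ofReal (hcint'.sub (hI' n)) (ae_of_all _ (hnn n))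
  have hmeas : ∀ n, Measurable fun p => ENNReal.ofReal (c p.1 p.2 - truncSum F G n p) :=
    fun n => (hcm.sub (((hFm.comp measurable_fst).min measurable_const).add
      ((hGm.comp measurable_snd).max measurable_const).ereal_toReal)).ennreal_ofReal
  -- Fatou: the gaps are non-negative and their `π'`-integrals tend to `0`.
  have hzero : ∫⁻ p, liminf (fun n => ENNReal.ofReal (c p.1 p.2 - truncSum F G n p)) atTop ∂π'
      = 0 := le_zero_iff.mp ((lintegral_liminf_le hmeas).trans_eq hgap.liminf_eq)
  rw [lintegral_eq_zero_iff (.liminf hmeas)] at hzero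
  filter_upwards [hzero] with p hp
  have hGC := hG p.2
  have hlep := hle p.1 p.2
  induction hs : G p.2 using EReal.rec with
  | bot =>
    -- Where `G = ⊥` the gap is at least `c - F + n`, so its lower limit cannot vanish.
    have hinf : Tendsto (fun n => ENNReal.ofReal (c p.1 p.2 - truncSum F G n p)) atTop (𝓝 ⊤) := by
      refine ENNReal.tendsto_ofReal_nhds_top.mpr ?_
      refine tendsto_atTop_mono (fun n => ?_)
        (tendsto_atTop_add_const_left atTop (c p.1 p.2 - F p.1) tendsto_natCast_atTop_atTop)
      rw [truncSum_of_bot hs]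
      linarith [min_le_left (F p.1) n]
    rw [hinf.liminf_eq] at hp
    exact absurd hp (by simp)
  | top => rw [hs] at hGC; exact absurd hGC (by simp)
  | coe s =>
    have hev : Tendsto (fun n => ENNReal.ofReal (c p.1 p.2 - truncSum F G n p)) atTop
        (𝓝 (ENNReal.ofReal (c p.1 p.2 - (F p.1 + s)))) :=
      tendsto_nhds_of_eventually_eq <| (eventually_truncSum_eq hs).mono fun n hn => by rw [hn]
    rw [hev.liminf_eq, Pi.zero_apply, ENNReal.ofReal_eq_zero] at hp
    rw [hs, ← EReal.coe_add, EReal.coe_le_coe_iff] at hlep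
    rw [← EReal.coe_add, EReal.coe_eq_coe_iff]
    linarith

theorem coe_add_cConjugate_le {X Y : Type*} (c : X → Y → ℝ) (F : X → ℝ) (x : X) (y : Y) :
    (F x : EReal) + cConjugate c (fun x => (F x : EReal)) y ≤ (c x y : EReal) := by
  refine (add_le_add_right (cConjugate_le c F x y) _).trans_eq ?_
  rw [← EReal.coe_add, add_sub_cancel]

/-- The contact set of a Kantorovich potential has full measure for every optimal plan. -/
theorem ae_mem_contactSet {X Y : Type*} [TopologicalSpace X] [TopologicalSpace Y]
    [MeasurableSpace X] [BorelSpace X] [MeasurableSpace Y] [BorelSpace Y]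
    [SecondCountableTopology X] [SecondCountableTopology Y]
    {μ : Measure X} [IsProbabilityMeasure μ] {ν : Measure Y} [IsProbabilityMeasure ν]
    {c : X → Y → ℝ} (hc_nonneg : ∀ x y, 0 ≤ c x y) (hc : Continuous fun p : X × Y => c p.1 p.2)
    (hT : transportCost c μ ν < ⊤) {F : X → ℝ} (hFc : Continuous F) {C : ℝ}
    (hF : ∀ x, -C ≤ F x) (hG : ∀ y, cConjugate c (fun x => (F x : EReal)) y ≤ (C : EReal))
    (hK : (fun x => (F x : EReal)) ∈ kantorovichPotentials c μ ν)
    {π' : Measure (X × Y)} (hπ' : π' ∈ transportPlans μ ν)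
    (hopt : planCost c π' = transportCost c μ ν) : ∀ᵐ p ∂π', p ∈ contactSet c F := by
  obtain ⟨-, π, hπ, hcost, hext⟩ := hK
  have hGm := measurable_cConjugate hc F
  have hsum : Measurable fun p : X × Y =>
      (F p.1 : EReal) + cConjugate c (fun x => (F x : EReal)) p.2 :=
    (hFc.measurable.coe_real_ereal.comp measurable_fst).add (hGm.comp measurable_snd)
  have h1 := ae_eq_of_extIntegral_eq hsum hc.measurable (fun p => hc_nonneg p.1 p.2)
    (fun p => coe_add_cConjugate_le c F p.1 p.2)
    (by change planCost c π ≠ ⊤; rw [hcost]; exact hT.ne)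
    (by rw [hext, ← hcost]; rfl)
  have h2 := ae_add_eq_of_ae_add_eq hc_nonneg hc.measurable hFc.measurable hGm hF hG
    (coe_add_cConjugate_le c F) hπ hπ' (hopt.trans hcost.symm) (hcost ▸ hT.ne) h1
  filter_upwards [h2] with p hp
  refine mem_contactSet_of_le ?_
  rw [EReal.coe_sub, ← hp, EReal.add_sub_cancel_left]

/-! ### Local constancy and conclusion -/

/-- The difference of two `c`-concave functions with common contact points over an open set is
locally constant there. -/
theorem eventually_sub_eq_of_contactSet {d : ℕ} {X Y : Type*} [TopologicalSpace X]
    [ChartedSpace (EuclideanSpace ℝ (Fin d)) X]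
    [IsManifold (𝓘(ℝ, EuclideanSpace ℝ (Fin d))) ∞ X] {c : X → Y → ℝ}
    (hc_diff : ∀ y, MDifferentiable (𝓘(ℝ, EuclideanSpace ℝ (Fin d))) (𝓘(ℝ, ℝ)) (fun x => c x y))
    (hc_lip : LocallyLipschitzUniformly (H := EuclideanSpace ℝ (Fin d)) c)
    {F₁ F₂ : X → ℝ} (h₁ : IsCConcave c fun x => (F₁ x : EReal))
    (h₂ : IsCConcave c fun x => (F₂ x : EReal)) {M : Set X} (hM : IsOpen M)
    (hΓ : ∀ x ∈ M, ∃ y, (x, y) ∈ contactSet c F₁ ∩ contactSet c F₂) {x : X} (hx : x ∈ M) :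
    ∀ᶠ z in 𝓝 x, F₁ z - F₂ z = F₁ x - F₂ x := by
  set φ := chartAt (EuclideanSpace ℝ (Fin d)) x with hφ
  have hφa : φ ∈ atlas (EuclideanSpace ℝ (Fin d)) X := chart_mem_atlas _ x
  have hxs : x ∈ φ.source := mem_chart_source _ x
  have hxt : φ x ∈ φ.target := φ.map_source hxs
  obtain ⟨K, U, hU, hUt, hK⟩ := hc_lip φ hφa (φ x) hxt
  have hMn : φ.symm ⁻¹' M ∈ 𝓝 (φ x) := by
    refine (φ.continuousAt_symm hxt).preimage_mem_nhds ?_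
    rw [φ.left_inv hxs]
    exact hM.mem_nhds hx
  obtain ⟨r, hr, hball⟩ := Metric.mem_nhds_iff.mp (inter_mem hU hMn)
  have hconst : ∀ v ∈ Metric.ball (φ x) r,
      F₁ (φ.symm v) - F₂ (φ.symm v) = F₁ (φ.symm (φ x)) - F₂ (φ.symm (φ x)) := fun v hv => by
    refine sub_eq_sub_of_common_upper_support (f₁ := fun u => F₁ (φ.symm u))
      (f₂ := fun u => F₂ (φ.symm u)) (convex_ball (φ x) r) Metric.isOpen_ball
      ((lipschitzOnWith_of_isCConcave h₁ hK).mono fun u hu => (hball hu).1)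
      ((lipschitzOnWith_of_isCConcave h₂ hK).mono fun u hu => (hball hu).1)
      (fun u hu => ?_) (Metric.mem_ball_self hr) hv
    obtain ⟨y, hy₁, hy₂⟩ := hΓ (φ.symm u) (hball hu).2
    -- The common support function is the cost itself, read in the chart.
    refine ⟨fun w => c (φ.symm w) y, ?_, fun w _ => ?_, fun w _ => ?_⟩
    · have hs := mdifferentiableAt_atlas_symm (I := 𝓘(ℝ, EuclideanSpace ℝ (Fin d)))
        hφa (hUt (hball hu).1)
      exact ((hc_diff y (φ.symm u)).comp u hs).differentiableAt
    · have := hy₁ (φ.symm w)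
      simp only at this
      linarith
    · have := hy₂ (φ.symm w)
      simp only at this
      linarith
  filter_upwards [φ.open_source.mem_nhds hxs,
    (φ.continuousAt hxs).preimage_mem_nhds (Metric.ball_mem_nhds (φ x) hr)] with z hz hzb
  simpa only [φ.left_inv hz, φ.left_inv hxs] using hconst (φ z) hzb

theorem mainTheorem4 {d : ℕ} {X Y : Type*}
    [TopologicalSpace X] [PolishSpace X] [MeasurableSpace X] [BorelSpace X]
    [ChartedSpace (EuclideanSpace ℝ (Fin d)) X]
    [IsManifold (𝓘(ℝ, EuclideanSpace ℝ (Fin d))) ∞ X]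
    [TopologicalSpace Y] [PolishSpace Y] [CompactSpace Y] [MeasurableSpace Y] [BorelSpace Y]
    (μ : Measure X) [IsProbabilityMeasure μ] (ν : Measure Y) [IsProbabilityMeasure ν]
    (c : X → Y → ℝ) (hc_nonneg : ∀ x y, 0 ≤ c x y)
    (hc_cont : Continuous (fun p : X × Y => c p.1 p.2))
    (hc_diff : ∀ y, MDifferentiable (𝓘(ℝ, EuclideanSpace ℝ (Fin d))) (𝓘(ℝ, ℝ)) (fun x => c x y))
    (hc_lip : LocallyLipschitzUniformly (H := EuclideanSpace ℝ (Fin d)) c)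
    (hT : transportCost c μ ν < ⊤)
    (hM_conn : IsConnected (interior μ.support))
    (hM_cl : closure (interior μ.support) = μ.support) :
    AlmostSurelyUniquePotentials c μ ν := by
  intro f₁ hf₁ f₂ hf₂
  obtain ⟨F₁, C₁, rfl, hF₁, hG₁⟩ := hf₁.1.exists_real hc_nonneg hc_cont
  obtain ⟨F₂, C₂, rfl, hF₂, hG₂⟩ := hf₂.1.exists_real hc_nonneg hc_cont
  have hc₁ := continuous_of_isCConcave hc_lip hf₁.1
  have hc₂ := continuous_of_isCConcave hc_lip hf₂.1
  -- The plan of `f₁` serves for `f₂` as well, since only its optimality is used.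
  obtain ⟨-, π, hπ, hopt, -⟩ := id hf₁
  have hΓ : ∀ x ∈ μ.support, ∃ y, (x, y) ∈ contactSet c F₁ ∩ contactSet c F₂ := fun x hx => by
    refine exists_mem_of_mem_support_map_fst
      ((isClosed_contactSet hc_cont hc₁).inter (isClosed_contactSet hc_cont hc₂))
      (π := π) ?_ (by rwa [hπ.1])
    exact (ae_mem_contactSet hc_nonneg hc_cont hT hc₁ hF₁ hG₁ hf₁ hπ hopt).and
      (ae_mem_contactSet hc_nonneg hc_cont hT hc₂ hF₂ hG₂ hf₂ hπ hopt)
  obtain ⟨x₀, hx₀⟩ := hM_conn.nonempty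
  have : PreconnectedSpace (interior μ.support) :=
    isPreconnected_iff_preconnectedSpace.mp hM_conn.isPreconnected
  have hloc : IsLocallyConstant fun x : interior μ.support => F₁ x - F₂ x := by
    refine (IsLocallyConstant.iff_eventually_eq _).mpr fun x => ?_
    exact continuous_subtype_val.continuousAt.eventually
      (eventually_sub_eq_of_contactSet hc_diff hc_lip hf₁.1 hf₂.1 isOpen_interior
        (fun z hz => hΓ z (interior_subset hz)) x.2)
  have hsupp : μ.support ⊆ {x | F₁ x - F₂ x = F₁ x₀ - F₂ x₀} := by
    rw [← hM_cl]
    refine closure_minimal (fun x hx => ?_) (isClosed_eq (hc₁.sub hc₂) continuous_const)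
    exact hloc.apply_eq_of_preconnectedSpace ⟨x, hx⟩ ⟨x₀, hx₀⟩
  refine ⟨F₁ x₀ - F₂ x₀, ?_⟩
  filter_upwards [μ.support_mem_ae] with x hx
  rw [← EReal.coe_sub, hsupp hx]
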